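/- Let $G=(V,E)$ be a finite graph, with one (unordered) edge $\{i,j\}$ for each adjacent pair of distinct vertices (for instance the complete graph on $V$), and let $X=V\cup E$ be partially ordered by $v\le e$ whenever $v$ is an endpoint of $e$. For $A\subseteq X$ put $\operatorname{cl}(A)=\{x\in X:\exists a\in A,\ x\le a\}$. A relation matrix is an arbitrary real matrix $W=(W(i,j))_{i,j\in V}$. For $\lambda\in\mathbb R$ let $\mathcal V_\lambda(W)$ be the graph multivector field at threshold $\lambda$: the finest partition of $X$ into blocks such that, for every edge $\{i,j\}$, the vertex $i$ and the edge $\{i,j\}$ lie in the same block whenever $W(i,j)>\lambda$ (and likewise $j$ and $\{i,j\}$ whenever $W(j,i)>\lambda$). The $M$-graph of $\mathcal V_\lambda(W)$ is the directed graph on the blocks with an arrow $A\to B$ whenever $B\cap(A\cup\operatorname{cl}(A))\neq\emptyset$. The Morse sets at threshold $\lambda$ are the strongly connected components of this graph, each regarded as the subset of $X$ that is the union of its blocks. The filtration is indexed by the real interval $\Lambda_W=[\min_{i\ne j}W(i,j),\ \max_{i\neq j}W(i,j)]$ (if $|V|\le 1$, all diagrams below are empty). For a set $M\subseteq X$ which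 is a Morse set at some threshold in $\Lambda_W$, its birth $\lambda_b$ and its death $\lambda_d$ are the supremum and the infimum of the $\lambda\in\Lambda_W$ at which $M$ is a Morse set; thus, as $\lambda$ decreases, $M$ appears at $\lambda_b$ and is merged into a larger Morse set at $\lambda_d$, and $\lambda_d$ is the smallest threshold if this never happens. The Morse persistence diagram $D_W$ is the multiset of the points $(\lambda_b,\lambda_d)$, one for each such $M$ with $\lambda_d<\lambda_b$ (points on the diagonal do not matter for the distance below). For finite multisets $D_1,D_2$ of points of $\mathbb R^2$, the bottleneck distance is $$d_B(D_1,D_2)=\inf_\eta\ \sup_{x}\ \|x-\eta(x)\|_\infty ,$$ where $\eta$ ranges over all bijections $D_1\cup\Delta\to D_2\cup\Delta$, $x$ ranges over $D_1\cup\Delta$, and $\Delta=\{(t,t):t\in\mathbb R\}$ is taken with countably infinite multiplicity. **Theorem (stability of Morse persistence diagrams).** Let $W$ and $W'$ be two relation matrices on the same finite graph $G$, and suppose that $\|W-W'\|_\infty=\sup_{i,j}|W(i,j)-W'(i,j)|\le\varepsilon$. Then $$d_B(D_W,D_{W'})\le\varepsilon .$$ -/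

import Mathlib

open scoped ENNReal

namespace MorsePersistence

universe u

section Graph

variable {V : Type u}

/-- The elements of the graph poset of `G`: the vertices and the (unordered) edges of `G`. -/
inductive Cell (G : SimpleGraph V) : Type u
  | vertex (v : V) : Cell G
  | edge (e : G.edgeSet) : Cell G

variable {G : SimpleGraph V}

/-- The face order: every vertex lies below each edge incident to it. -/
instance : PartialOrder (Cell G) where
  le x y := x = y ∨ ∃ v e, x = .vertex v ∧ y = .edge e ∧ v ∈ (e : Sym2 V)
  le_refl x := Or.inl rfl
  le_trans x y z := by
    rintro (rfl | ⟨v, e, rfl, rfl, h⟩) hyz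
    · exact hyz
    · rcases hyz with rfl | ⟨v', e', h', -, -⟩
      · exact Or.inr ⟨v, e, rfl, rfl, h⟩
      · cases h'
  le_antisymm x y := by
    rintro (rfl | ⟨v, e, rfl, rfl, h⟩) hyx
    · rfl
    · rcases hyx with h' | ⟨v', e', h', -, -⟩
      · exact h'.symm
      · cases h'

theorem Cell.le_def {x y : Cell G} :
    x ≤ y ↔ x = y ∨ ∃ v e, x = .vertex v ∧ y = .edge e ∧ v ∈ (e : Sym2 V) := Iff.rfl

instance [Finite V] : Finite (Cell G) := by
  have hf : Function.Injective
      (fun c : Cell G => (match c with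
        | .vertex v => Sum.inl v
        | .edge e => Sum.inr e : V ⊕ G.edgeSet)) := by
    intro x y h
    cases x <;> cases y <;> simp_all
  exact Finite.of_injective _ hf

/-- The graph poset has no chains of length two, so all its subsets are convex. -/
theorem Cell.ordConnected (A : Set (Cell G)) : A.OrdConnected := by
  refine ⟨fun x hx z hz y hy => ?_⟩
  rcases hy.1 with rfl | ⟨v, e, rfl, rfl, -⟩
  · exact hx
  · rcases hy.2 with rfl | ⟨v', e', h', -, -⟩
    · exact hz
    · cases h'

end Graph

section Poset

variable {X : Type u} [PartialOrder X]

/-- The closure of a subset of a finite poset, in the topology whose closed sets are the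
down-sets. -/
def cl (A : Set X) : Set X := {x | ∃ a ∈ A, x ≤ a}

variable (X) in
/-- A combinatorial multivector field: a partition (given by its equivalence relation) into
locally closed, i.e. convex, blocks. -/
structure MultivectorField extends Setoid X where
  convex : ∀ x, {y | toSetoid x y}.OrdConnected

namespace MultivectorField

variable (𝒱 : MultivectorField X)

/-- The multivectors, i.e. the blocks of the partition. -/
def multivectors : Set (Set X) := 𝒱.toSetoid.classes

/-- The image of a multivector under the multivalued map `Π x = [x] ∪ cl [x]`. -/
def image (A : Set X) : Set X := A ∪ cl A

/-- The `M`-graph: the nodes are the multivectors, with an arrow from `A` to `B` whenever `B`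
meets the image of `A`. -/
def MGraph : Digraph 𝒱.multivectors where
  Adj A B := ((B : Set X) ∩ image (A : Set X)).Nonempty

/-- There is a directed path (possibly of length zero) from `A` to `B` in the `M`-graph. -/
def Reaches (A B : 𝒱.multivectors) : Prop := Relation.ReflTransGen 𝒱.MGraph.Adj A B

/-- The strongly connected component of `A` in the `M`-graph, as a set of multivectors. -/
def scc (A : 𝒱.multivectors) : Set 𝒱.multivectors := {B | 𝒱.Reaches A B ∧ 𝒱.Reaches B A}

/-- The Morse sets: the strongly connected components of the `M`-graph, each one regarded as the
subset of `X` that is the union of its multivectors. -/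
def morseSets : Set (Set X) :=
  {M | ∃ A : 𝒱.multivectors, M = ⋃ B ∈ 𝒱.scc A, (B : Set X)}

end MultivectorField

end Poset

section Filtration

variable {V : Type u} (G : SimpleGraph V) (W : Matrix V V ℝ)

/-- The vertex `i` and the edge `{i, j}` are to be merged at threshold `t`: the relation from `i`
to `j` is active, i.e. `W i j > t`. -/
def Merge (t : ℝ) (x y : Cell G) : Prop :=
  ∃ (i j : V) (h : G.Adj i j), W i j > t ∧ x = .vertex i ∧ y = .edge ⟨s(i, j), h⟩

/-- The graph multivector field at threshold `t`: start from singletons, perform all active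
merges, and merge overlapping blocks transitively. -/
def field (t : ℝ) : MultivectorField (Cell G) where
  toSetoid := Relation.EqvGen.setoid (Merge G W t)
  convex _ := Cell.ordConnected _

/-- The critical thresholds: the off-diagonal entries of the relation matrix. -/
def critical : Set ℝ := {t | ∃ i j, i ≠ j ∧ W i j = t}

/-- The thresholds of the filtration: the interval from the smallest to the largest critical
value. -/
noncomputable def thresholds : Set ℝ := Set.Icc (sInf (critical W)) (sSup (critical W))

/-- The thresholds of the filtration at which `M` is a Morse set. -/
noncomputable def lifespan (M : Set (Cell G)) : Set ℝ :=
  {t ∈ thresholds W | M ∈ (field G W t).morseSets}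

/-- The birth of `M`: the filtration being scanned from large to small thresholds, this is where
`M` first appears. -/
noncomputable def birth (M : Set (Cell G)) : ℝ := sSup (lifespan G W M)

/-- The death of `M`: where it merges into a larger Morse set, or the smallest threshold of the
filtration if it never does. -/
noncomputable def death (M : Set (Cell G)) : ℝ := sInf (lifespan G W M)

/-- The Morse sets that appear along the filtration and have a positive lifetime. -/
def persistentMorseSets : Set (Set (Cell G)) :=
  {M | (lifespan G W M).Nonempty ∧ death G W M < birth G W M}

/-- The Morse persistence diagram: the multiset of the points `(birth, death)`, one for each Morse
set along the filtration. -/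
noncomputable def morseDiagram [Finite V] : Multiset (ℝ × ℝ) :=
  (Set.toFinite (persistentMorseSets G W)).toFinset.val.map fun M => (birth G W M, death G W M)

/-- The sup-norm distance of two relation matrices. -/
noncomputable def supDist (W W' : Matrix V V ℝ) : ℝ := ⨆ p : V × V, |W p.1 p.2 - W' p.1 p.2|

end Filtration

section Bottleneck

open Classical in
/-- The points of a diagram `D` with their multiplicities, together with infinitely many copies of
every point of the diagonal. -/
abbrev Augmented (D : Multiset (ℝ × ℝ)) : Type := D.ToType ⊕ (ℝ × ℕ)

open Classical in
/-- The point in the plane of an element of the augmented diagram. -/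
def Augmented.point {D : Multiset (ℝ × ℝ)} : Augmented D → ℝ × ℝ
  | .inl x => x.1
  | .inr t => (t.1, t.1)

/-- The bottleneck distance: the infimum, over all bijections between the two diagrams augmented
by the diagonal, of the largest displacement in the sup-norm of the plane (the distance of
`ℝ × ℝ`). -/
noncomputable def bottleneckDist (D₁ D₂ : Multiset (ℝ × ℝ)) : ℝ≥0∞ :=
  ⨅ η : Augmented D₁ ≃ Augmented D₂, ⨆ x : Augmented D₁, edist x.point (η x).point

end Bottleneck

end MorsePersistence

/-!
Write `~ₜ` for mutual reachability in the `M`-graph at threshold `t`; the Morse sets are its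
classes. It only grows when `t` decreases, and if `‖W - W'‖ ≤ ε`, then `~ₜ` for `W` is contained in
`~ᵤ` for `W'` whenever `u + ε ≤ t`, and vice versa. A set that is a class of two nested equivalence
relations is a class of every relation between them. Hence, if `M` is a Morse set of `W` at `s` and
at `t`, it is one of `W'` throughout `[s + ε, t - ε]`. So a Morse set of `W` or of `W'` that lives
longer than `2 * ε` is one of both, with births and deaths at distance at most `ε`, and all other
points are `ε`-close to the diagonal.
-/

namespace MorsePersistence

section Bottleneck

theorem bottleneckDist_comm (D₁ D₂ : Multiset (ℝ × ℝ)) :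
    bottleneckDist D₁ D₂ = bottleneckDist D₂ D₁ :=
  (Equiv.symmEquiv _ _).iInf_congr fun η => η.symm.iSup_congr fun x => by
    simp [edist_comm]

theorem bottleneckDist_map_map_le {α : Type*} {s : Multiset α} {f g : α → ℝ × ℝ} {δ : ℝ≥0∞}
    (h : ∀ a ∈ s, edist (f a) (g a) ≤ δ) : bottleneckDist (s.map f) (s.map g) ≤ δ := by
  classical
  refine iInf_le_of_le
    (((s.mapEquiv f).symm.trans (s.mapEquiv g)).sumCongr (Equiv.refl _)) (iSup_le ?_)
  rintro (x | t)
  · obtain ⟨a, rfl⟩ := (s.mapEquiv f).surjective x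
    simpa [Augmented.point] using h a Multiset.coe_mem
  · simp [Augmented.point]

theorem exists_equiv_sum_prod_nat {ι α : Type*} [Countable ι] (τ : ι → α) :
    ∃ e : ι ⊕ (α × ℕ) ≃ α × ℕ, ∀ x, (e x).1 = Sum.elim τ Prod.fst x := by
  have absorb : ∀ t, Nonempty ({i // τ i = t} ⊕ ℕ ≃ ℕ) := fun t => nonempty_equiv_of_countable
  refine ⟨(((Equiv.sigmaFiberEquiv τ).symm.sumCongr (Equiv.sigmaEquivProd α ℕ).symm).trans
    (Equiv.sigmaSumDistrib _ _).symm).trans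
    ((Equiv.sigmaCongrRight fun t => (absorb t).some).trans (Equiv.sigmaEquivProd α ℕ)), ?_⟩
  rintro (i | t) <;> rfl

theorem bottleneckDist_zero_right_le {D : Multiset (ℝ × ℝ)} {δ : ℝ≥0∞}
    (h : ∀ p ∈ D, ∃ t : ℝ, edist p (t, t) ≤ δ) : bottleneckDist D 0 ≤ δ := by
  classical
  choose! τ hτ using h
  obtain ⟨e, he⟩ := exists_equiv_sum_prod_nat fun x : D => τ x
  refine iInf_le_of_le (e.trans (Equiv.emptySum (Multiset.ToType 0) _).symm) (iSup_le fun x => ?_)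
  change edist x.point ((e x).1, (e x).1) ≤ δ
  rw [he]
  rcases x with p | t
  · exact hτ p Multiset.coe_mem
  · simp [Augmented.point]

theorem exists_equiv_toType_add {α : Type*} [DecidableEq α] (D E : Multiset α) :
    ∃ e : D.ToType ⊕ E.ToType ≃ (D + E).ToType,
      ∀ x, (e x).1 = Sum.elim Sigma.fst Sigma.fst x := by
  refine ⟨(Equiv.sigmaSumDistrib _ _).symm.trans (Equiv.sigmaCongrRight fun a =>
    finSumFinEquiv.trans (finCongr (Multiset.count_add a D E).symm)), ?_⟩
  rintro (x | x) <;> rfl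

theorem exists_equiv_augmented_add (D E : Multiset (ℝ × ℝ)) :
    ∃ e : Augmented D ⊕ Augmented E ≃ Augmented (D + E),
      ∀ x, (e x).point = Sum.elim Augmented.point Augmented.point x := by
  classical
  obtain ⟨e, he⟩ := exists_equiv_toType_add D E
  let fold : (ℝ × ℕ) ⊕ (ℝ × ℕ) ≃ ℝ × ℕ :=
    (Equiv.prodSumDistrib ℝ ℕ ℕ).symm.trans ((Equiv.refl ℝ).prodCongr Equiv.natSumNatEquivNat)
  refine ⟨(Equiv.sumSumSumComm _ _ _ _).trans (e.sumCongr fold), ?_⟩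
  rintro ((x | t) | (x | t))
  · exact he (.inl x)
  · rfl
  · exact he (.inr x)
  · rfl

theorem bottleneckDist_add_add_le (D₁ D₂ E₁ E₂ : Multiset (ℝ × ℝ)) :
    bottleneckDist (D₁ + E₁) (D₂ + E₂) ≤ bottleneckDist D₁ D₂ ⊔ bottleneckDist E₁ E₂ := by
  obtain ⟨e₁, he₁⟩ := exists_equiv_augmented_add D₁ E₁
  obtain ⟨e₂, he₂⟩ := exists_equiv_augmented_add D₂ E₂
  rw [bottleneckDist, bottleneckDist, bottleneckDist, iInf_sup_iInf]
  refine le_iInf fun ⟨η, θ⟩ => iInf_le_of_le ((e₁.symm.trans (η.sumCongr θ)).trans e₂)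
    (iSup_le fun x => ?_)
  obtain ⟨y | y, rfl⟩ := e₁.surjective x <;>
    simp only [Equiv.trans_apply, Equiv.symm_apply_apply, Equiv.sumCongr_apply, Sum.map_inl,
      Sum.map_inr, he₁, he₂, Sum.elim_inl, Sum.elim_inr]
  · exact (le_iSup (fun y => edist (Augmented.point y) (η y).point) y).trans le_sup_left
  · exact (le_iSup (fun y => edist (Augmented.point y) (θ y).point) y).trans le_sup_right

theorem bottleneckDist_map_le {α : Type*} {S T U : Finset α} {f g : α → ℝ × ℝ} {δ : ℝ≥0∞}
    (hUS : U ⊆ S) (hUT : U ⊆ T) (hU : ∀ a ∈ U, edist (f a) (g a) ≤ δ)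
    (hS : ∀ a ∈ S, a ∉ U → ∃ t : ℝ, edist (f a) (t, t) ≤ δ)
    (hT : ∀ a ∈ T, a ∉ U → ∃ t : ℝ, edist (g a) (t, t) ≤ δ) :
    bottleneckDist (S.val.map f) (T.val.map g) ≤ δ := by
  classical
  have split {R : Finset α} (h : α → ℝ × ℝ) (hR : U ⊆ R) :
      R.val.map h = U.val.map h + (R \ U).val.map h := by
    rw [← Multiset.map_add, Finset.sdiff_val, add_tsub_cancel_of_le (Finset.val_le_iff.2 hR)]
  have near {R : Finset α} {h : α → ℝ × ℝ}
      (hR : ∀ a ∈ R, a ∉ U → ∃ t : ℝ, edist (h a) (t, t) ≤ δ) :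
      bottleneckDist ((R \ U).val.map h) 0 ≤ δ := by
    refine bottleneckDist_zero_right_le (Multiset.forall_mem_map_iff.2 fun a ha => ?_)
    obtain ⟨haR, haU⟩ := Finset.mem_sdiff.1 ha
    exact hR a haR haU
  rw [split f hUS, split g hUT]
  calc _ ≤ bottleneckDist (U.val.map f) (U.val.map g) ⊔
          bottleneckDist ((S \ U).val.map f) ((T \ U).val.map g) :=
        bottleneckDist_add_add_le ..
    _ ≤ bottleneckDist (U.val.map f) (U.val.map g) ⊔
          (bottleneckDist ((S \ U).val.map f) 0 ⊔ bottleneckDist 0 ((T \ U).val.map g)) := by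
        gcongr
        simpa using bottleneckDist_add_add_le ((S \ U).val.map f) 0 0 ((T \ U).val.map g)
    _ ≤ δ := sup_le (bottleneckDist_map_map_le hU)
        (sup_le (near hS) ((bottleneckDist_comm _ _).trans_le (near hT)))

end Bottleneck

section Erosion

/-- Between any two points of `L`, each moved towards the other by `ε`, everything lies in `L'`.
For intervals, this is the one-sided condition in the definition of the erosion distance. -/
def ErodesInto (ε : ℝ) (L L' : Set ℝ) : Prop := ∀ s ∈ L, ∀ t ∈ L, Set.Icc (s + ε) (t - ε) ⊆ L'

theorem nonempty_of_sInf_lt_sSup {L : Set ℝ} (h : sInf L < sSup L) : L.Nonempty :=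
  Set.nonempty_iff_ne_empty.2 fun hL => by simp [hL] at h

variable {ε : ℝ} {L L' : Set ℝ}

theorem ErodesInto.sSup_sub_le (h : ErodesInto ε L L') (hL' : BddAbove L') (hε : 0 ≤ ε)
    (hlong : sInf L + 2 * ε < sSup L) : sSup L - ε ≤ sSup L' := by
  have hne : L.Nonempty := nonempty_of_sInf_lt_sSup (by linarith)
  refine le_of_forall_lt fun c hc => ?_
  obtain ⟨t, ht, hct⟩ := exists_lt_of_lt_csSup hne (max_lt hlong (lt_sub_iff_add_lt.1 hc))
  rw [max_lt_iff] at hct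
  obtain ⟨s, hs, hst⟩ := exists_lt_of_csInf_lt hne (lt_sub_iff_add_lt.2 hct.1)
  have ht' : t - ε ∈ L' := h s hs t ht ⟨by linarith, le_rfl⟩
  exact (lt_sub_iff_add_lt.2 hct.2).trans_le (le_csSup hL' ht')

theorem ErodesInto.sInf_le_add (h : ErodesInto ε L L') (hL' : BddBelow L') (hε : 0 ≤ ε)
    (hlong : sInf L + 2 * ε < sSup L) : sInf L' ≤ sInf L + ε := by
  have hne : L.Nonempty := nonempty_of_sInf_lt_sSup (by linarith)
  refine le_of_forall_gt fun c hc => ?_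
  obtain ⟨s, hs, hsc⟩ := exists_lt_of_csInf_lt hne
    (lt_min (lt_sub_iff_add_lt.2 hlong) (lt_sub_iff_add_lt.2 hc))
  rw [lt_min_iff] at hsc
  obtain ⟨t, ht, hst⟩ := exists_lt_of_lt_csSup hne (lt_sub_iff_add_lt.1 hsc.1)
  have hs' : s + ε ∈ L' := h s hs t ht ⟨le_rfl, by linarith⟩
  exact (csInf_le hL' hs').trans_lt (lt_sub_iff_add_lt.1 hsc.2)

theorem ErodesInto.sInf_lt_sSup (h : ErodesInto ε L L') (hL' : Bornology.IsBounded L')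
    (hε : 0 ≤ ε) (hlong : sInf L + 2 * ε < sSup L) : sInf L' < sSup L' := by
  linarith [h.sSup_sub_le hL'.bddAbove hε hlong, h.sInf_le_add hL'.bddBelow hε hlong]

theorem ErodesInto.dist_sSup_sInf_le (h : ErodesInto ε L L') (h' : ErodesInto ε L' L)
    (hL : Bornology.IsBounded L) (hL' : Bornology.IsBounded L') (hε : 0 ≤ ε)
    (hlong : sInf L + 2 * ε < sSup L) : dist (sSup L, sInf L) (sSup L', sInf L') ≤ ε := by
  have hsup := h.sSup_sub_le hL'.bddAbove hε hlong
  have hinf := h.sInf_le_add hL'.bddBelow hε hlong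
  suffices sSup L' - ε ≤ sSup L ∧ sInf L ≤ sInf L' + ε by
    rw [Prod.dist_eq, Real.dist_eq, Real.dist_eq]
    exact max_le (abs_le.2 (by constructor <;> linarith)) (abs_le.2 (by constructor <;> linarith))
  rcases lt_or_ge (sInf L' + 2 * ε) (sSup L') with hlong' | hshort'
  · exact ⟨h'.sSup_sub_le hL.bddAbove hε hlong', h'.sInf_le_add hL.bddBelow hε hlong'⟩
  -- `sSup L' ≤ sInf L' + 2 * ε ≤ sInf L + 3 * ε < sSup L + ε`, and dually.
  · constructor <;> linarith

theorem exists_edist_diagonal_le {p : ℝ × ℝ} (h : |p.1 - p.2| ≤ 2 * ε) :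
    ∃ t : ℝ, edist p (t, t) ≤ ENNReal.ofReal ε := by
  refine ⟨(p.1 + p.2) / 2, ?_⟩
  rw [edist_dist]
  refine ENNReal.ofReal_le_ofReal (max_le ?_ ?_) <;> rw [Real.dist_eq, abs_le] <;>
    constructor <;> linarith [abs_le.1 h]

theorem bottleneckDist_map_sSup_sInf_le {α : Type*} {L L' : α → Set ℝ} {S S' : Finset α}
    (hL : ∀ a, Bornology.IsBounded (L a)) (hL' : ∀ a, Bornology.IsBounded (L' a))
    (hS : ∀ a, a ∈ S ↔ sInf (L a) < sSup (L a))
    (hS' : ∀ a, a ∈ S' ↔ sInf (L' a) < sSup (L' a)) (hε : 0 ≤ ε)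
    (h : ∀ a, ErodesInto ε (L a) (L' a)) (h' : ∀ a, ErodesInto ε (L' a) (L a)) :
    bottleneckDist (S.val.map fun a => (sSup (L a), sInf (L a)))
      (S'.val.map fun a => (sSup (L' a), sInf (L' a))) ≤ ENNReal.ofReal ε := by
  classical
  have short {K : Set ℝ} (hlt : sInf K < sSup K) (hK : ¬ sInf K + 2 * ε < sSup K) :
      ∃ t : ℝ, edist (sSup K, sInf K) (t, t) ≤ ENNReal.ofReal ε := by
    refine exists_edist_diagonal_le ?_
    rw [abs_of_pos (sub_pos.2 hlt)]
    linarith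
  let U := {a ∈ S ∪ S' |
    sInf (L a) + 2 * ε < sSup (L a) ∨ sInf (L' a) + 2 * ε < sSup (L' a)}
  have long {a} (ha : a ∈ U) := (Finset.mem_filter.1 ha).2
  refine bottleneckDist_map_le (U := U) (fun a ha => (hS a).2 ?_) (fun a ha => (hS' a).2 ?_)
    (fun a ha => ?_) (fun a ha haU => ?_) (fun a ha haU => ?_)
  · rcases long ha with hlong | hlong'
    · linarith
    · exact (h' a).sInf_lt_sSup (hL a) hε hlong'
  · rcases long ha with hlong | hlong'
    · exact (h a).sInf_lt_sSup (hL' a) hε hlong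
    · linarith
  · rw [edist_dist]
    refine ENNReal.ofReal_le_ofReal ?_
    rcases long ha with hlong | hlong'
    · exact (h a).dist_sSup_sInf_le (h' a) (hL a) (hL' a) hε hlong
    · exact dist_comm (α := ℝ × ℝ) _ _ ▸
        (h' a).dist_sSup_sInf_le (h a) (hL' a) (hL a) hε hlong'
  · exact short ((hS a).1 ha) fun hlong =>
      haU (Finset.mem_filter.2 ⟨Finset.mem_union_left _ ha, .inl hlong⟩)
  · exact short ((hS' a).1 ha) fun hlong' =>
      haU (Finset.mem_filter.2 ⟨Finset.mem_union_right _ ha, .inr hlong'⟩)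

end Erosion

section MorseSets

variable {X : Type*}

theorem mem_classes_of_le_of_le {p q r : Setoid X} (hpq : p ≤ q) (hqr : q ≤ r) {M : Set X}
    (hp : M ∈ p.classes) (hr : M ∈ r.classes) : M ∈ q.classes := by
  obtain ⟨x, rfl⟩ := hp
  obtain ⟨z, hz⟩ := hr
  have hx : r x z := hz.subset (p.refl x)
  exact ⟨x, Set.Subset.antisymm (fun y hy => hpq hy)
    fun y hy => hz.superset (r.trans (hqr hy) hx)⟩

namespace MultivectorField

variable [PartialOrder X] (𝒱 : MultivectorField X)

/-- One step of the multivalued map `Π x = [x] ∪ cl {x}`, from `x` to `y`. It lifts the arrows of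
the `M`-graph to elements of `X`. -/
def Step (x y : X) : Prop := 𝒱.toSetoid x y ∨ y ≤ x

instance : IsPreorder X (Relation.ReflTransGen 𝒱.Step) where

/-- Mutual reachability along `Step`. Unlike the `M`-graph, it lives on `X` itself, so that it can
be compared between different multivector fields. -/
def mutualReach : Setoid X := AntisymmRel.setoid X (Relation.ReflTransGen 𝒱.Step)

variable {𝒱}

theorem mutualReach_mono {𝒲 : MultivectorField X} (h : 𝒱.toSetoid ≤ 𝒲.toSetoid) :
    𝒱.mutualReach ≤ 𝒲.mutualReach :=
  have hstep : 𝒱.Step ≤ 𝒲.Step := fun _ _ => Or.imp_left (h ·)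
  fun _ _ hxy => ⟨Relation.ReflTransGen.mono hstep _ _ hxy.1,
    Relation.ReflTransGen.mono hstep _ _ hxy.2⟩

theorem step_of_mem {A : 𝒱.multivectors} {x y : X} (hx : x ∈ (A : Set X))
    (hy : y ∈ (A : Set X)) : 𝒱.Step x y :=
  .inl (𝒱.toSetoid.rel_iff_exists_classes.2 ⟨A, A.2, hx, hy⟩)

theorem exists_mem_multivector (x : X) : ∃ A : 𝒱.multivectors, x ∈ (A : Set X) :=
  ⟨⟨_, 𝒱.toSetoid.mem_classes x⟩, 𝒱.toSetoid.refl x⟩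

theorem mGraph_adj_of_step {A B : 𝒱.multivectors} {x y : X} (hx : x ∈ (A : Set X))
    (hy : y ∈ (B : Set X)) (h : 𝒱.Step x y) : 𝒱.MGraph.Adj A B := by
  refine ⟨y, hy, ?_⟩
  rcases h with h | h
  · obtain ⟨c, hc, hxc, hyc⟩ := 𝒱.toSetoid.rel_iff_exists_classes.1 h
    exact .inl (Setoid.eq_of_mem_classes hc hxc A.2 hx ▸ hyc)
  · exact .inr ⟨x, hx, h⟩

theorem reaches_iff {A B : 𝒱.multivectors} {x y : X} (hx : x ∈ (A : Set X))
    (hy : y ∈ (B : Set X)) : 𝒱.Reaches A B ↔ Relation.ReflTransGen 𝒱.Step x y := by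
  constructor <;> intro h
  · induction h generalizing y with
    | refl => exact .single (step_of_mem hx hy)
    | tail _ hadj ih =>
      obtain ⟨z, hz, hz' | ⟨a, ha, hza⟩⟩ := hadj
      · exact (ih hz').tail (step_of_mem hz hy)
      · exact ((ih ha).tail (.inr hza)).tail (step_of_mem hz hy)
  · induction h generalizing B with
    | refl => exact .single (mGraph_adj_of_step hx hy (.inl (𝒱.toSetoid.refl x)))
    | tail _ hstep ih =>
      obtain ⟨C, hC⟩ := exists_mem_multivector (𝒱 := 𝒱) _
      exact (ih hC).tail (mGraph_adj_of_step hC hy hstep)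

theorem iUnion_scc_eq {A : 𝒱.multivectors} {x : X} (hx : x ∈ (A : Set X)) :
    ⋃ B ∈ 𝒱.scc A, (B : Set X) = {y | 𝒱.mutualReach y x} := by
  ext y
  simp only [Set.mem_iUnion, exists_prop]
  constructor
  · rintro ⟨B, ⟨hAB, hBA⟩, hy⟩
    exact ⟨(reaches_iff hy hx).1 hBA, (reaches_iff hx hy).1 hAB⟩
  · rintro ⟨hyx, hxy⟩
    obtain ⟨B, hy⟩ := exists_mem_multivector y
    exact ⟨B, ⟨(reaches_iff hx hy).2 hxy, (reaches_iff hy hx).2 hyx⟩, hy⟩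

theorem morseSets_eq_classes : 𝒱.morseSets = 𝒱.mutualReach.classes := by
  ext M
  constructor
  · rintro ⟨A, rfl⟩
    obtain ⟨x, hx⟩ := Setoid.nonempty_of_mem_partition 𝒱.toSetoid.isPartition_classes A.2
    exact ⟨x, iUnion_scc_eq hx⟩
  · rintro ⟨x, rfl⟩
    obtain ⟨A, hx⟩ := exists_mem_multivector x
    exact ⟨A, (iUnion_scc_eq hx).symm⟩

end MultivectorField

end MorseSets

section Stability

variable {V : Type*} {G : SimpleGraph V} {W W' : Matrix V V ℝ}

theorem field_toSetoid_mono {s t : ℝ} (h : ∀ i j, t < W i j → s < W' i j) :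
    (field G W t).toSetoid ≤ (field G W' s).toSetoid :=
  have hmerge : Merge G W t ≤ Merge G W' s :=
    fun _ _ ⟨i, j, hij, hW, hx, hy⟩ => ⟨i, j, hij, h i j hW, hx, hy⟩
  fun _ _ => Relation.EqvGen.mono hmerge _ _

theorem isBounded_lifespan (M : Set (Cell G)) : Bornology.IsBounded (lifespan G W M) :=
  (Metric.isBounded_Icc _ _).subset fun _ ht => ht.1

theorem supDist_comm (W W' : Matrix V V ℝ) : supDist W W' = supDist W' W := by
  simp only [supDist, abs_sub_comm]

theorem supDist_nonneg (W W' : Matrix V V ℝ) : 0 ≤ supDist W W' :=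
  Real.iSup_nonneg fun _ => abs_nonneg _

theorem critical_eq_empty [Subsingleton V] : critical W = ∅ :=
  Set.eq_empty_of_forall_notMem fun _ ⟨i, j, hij, _⟩ => hij (Subsingleton.elim i j)

theorem critical_nonempty [Nontrivial V] : (critical W).Nonempty :=
  have ⟨i, j, hij⟩ := exists_pair_ne V
  ⟨W i j, i, j, hij, rfl⟩

theorem mem_persistentMorseSets_iff {M : Set (Cell G)} :
    M ∈ persistentMorseSets G W ↔ sInf (lifespan G W M) < sSup (lifespan G W M) :=
  and_iff_right_of_imp nonempty_of_sInf_lt_sSup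

variable [Finite V] {ε : ℝ}

theorem abs_sub_le_supDist (i j : V) : |W i j - W' i j| ≤ supDist W W' :=
  le_ciSup (f := fun p : V × V => |W p.1 p.2 - W' p.1 p.2|) (Set.finite_range _).bddAbove (i, j)

theorem finite_critical : (critical W).Finite :=
  (Set.finite_range fun p : V × V => W p.1 p.2).subset fun _ ⟨i, j, _, h⟩ => ⟨(i, j), h⟩

theorem sInf_critical_le_add [Nontrivial V] (h : supDist W W' ≤ ε) :
    sInf (critical W') ≤ sInf (critical W) + ε := by
  obtain ⟨i, j, hij, hmin⟩ := critical_nonempty.csInf_mem (finite_critical (W := W))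
  have hle : sInf (critical W') ≤ W' i j := csInf_le finite_critical.bddBelow ⟨i, j, hij, rfl⟩
  linarith [(abs_le.1 ((abs_sub_le_supDist i j).trans h)).1]

theorem sSup_critical_sub_le [Nontrivial V] (h : supDist W W' ≤ ε) :
    sSup (critical W) - ε ≤ sSup (critical W') := by
  obtain ⟨i, j, hij, hmax⟩ := critical_nonempty.csSup_mem (finite_critical (W := W))
  have hle : W' i j ≤ sSup (critical W') := le_csSup finite_critical.bddAbove ⟨i, j, hij, rfl⟩
  linarith [(abs_le.1 ((abs_sub_le_supDist i j).trans h)).2]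

theorem erodesInto_thresholds (h : supDist W W' ≤ ε) :
    ErodesInto ε (thresholds W) (thresholds W') := by
  rintro s ⟨hs, -⟩ t ⟨-, ht⟩ u ⟨hsu, hut⟩
  rcases subsingleton_or_nontrivial V
  · have hε := (supDist_nonneg W W').trans h
    simp only [critical_eq_empty, Real.sInf_empty, Real.sSup_empty, thresholds] at hs ht ⊢
    constructor <;> linarith
  · exact ⟨by linarith [sInf_critical_le_add h], by linarith [sSup_critical_sub_le h]⟩

theorem erodesInto_lifespan (h : supDist W W' ≤ ε) (M : Set (Cell G)) :
    ErodesInto ε (lifespan G W M) (lifespan G W' M) := by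
  rintro s ⟨hs, hsM⟩ t ⟨ht, htM⟩ u ⟨hsu, hut⟩
  refine ⟨erodesInto_thresholds h s hs t ht ⟨hsu, hut⟩, ?_⟩
  have hclose i j := abs_le.1 ((abs_sub_le_supDist (W := W) (W' := W') i j).trans h)
  rw [MultivectorField.morseSets_eq_classes] at hsM htM ⊢
  refine mem_classes_of_le_of_le
    (MultivectorField.mutualReach_mono (field_toSetoid_mono fun i j hW => ?_))
    (MultivectorField.mutualReach_mono (field_toSetoid_mono fun i j hW => ?_)) htM hsM
  · linarith [hclose i j]
  · linarith [hclose i j]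

end Stability

end MorsePersistence

theorem mainTheorem1 {V : Type*} [Finite V] (G : SimpleGraph V) (W W' : Matrix V V ℝ) (ε : ℝ)
    (hε : MorsePersistence.supDist W W' ≤ ε) :
    MorsePersistence.bottleneckDist (MorsePersistence.morseDiagram G W)
      (MorsePersistence.morseDiagram G W') ≤ ENNReal.ofReal ε :=
  MorsePersistence.bottleneckDist_map_sSup_sInf_le
    MorsePersistence.isBounded_lifespan MorsePersistence.isBounded_lifespan
    (fun _ => (Set.Finite.mem_toFinset _).trans MorsePersistence.mem_persistentMorseSets_iff)
    (fun _ => (Set.Finite.mem_toFinset _).trans MorsePersistence.mem_persistentMorseSets_iff)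
    ((MorsePersistence.supDist_nonneg W W').trans hε)
    (MorsePersistence.erodesInto_lifespan hε)
    (MorsePersistence.erodesInto_lifespan ((MorsePersistence.supDist_comm W' W).trans_le hε))
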